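/- Let $S$ be a dense subsemigroup of $((0,\infty),+)$. Write $\beta S$ for the semigroup of ultrafilters on the discrete semigroup $S$ (with $A\in p+q$ iff $\{x\in S:\{y\in S: x+y\in A\}\in q\}\in p$) and $O^+(S)=\{p\in\beta S: (0,\epsilon)\cap S\in p\text{ for all }\epsilon>0\}$. An idempotent of $O^+(S)$ is *minimal* if it is minimal among the idempotents of $O^+(S)$ for the order $q\le p\iff q+p=p+q=q$. A set $E\subseteq S$ is *central near zero* if it belongs to some minimal idempotent of $O^+(S)$, and *central$^*$ near zero* if it belongs to every minimal idempotent of $O^+(S)$. Suppose that for every positive integer $c$ the set $cS=\{cs:s\in S\}$ is central$^*$ near zero in $S$. A $p\times q$ matrix $A$ with rational entries is *image partition regular* if for every finite colouring of $\mathbb N=\{1,2,\dots\}$ there is $\vec x\in\mathbb N^q$ such that all entries of $A\vec x$ are elements of $\mathbb N$ of the same colour. It is a *first entries matrix* if no row is $\vec 0$ and there are positive rationals $d_1,\dots,d_q$ such that every row whose first nonzero entry is in column $l$ has the entry $d_l$ there. An $\omega\times\omega$ matrix $M$ with rational entries is a *segmented first entries matrix* if no row of $M$ is $\vec 0$, each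 row has only finitely many nonzero entries, and there is a strictly increasing sequence $0=\alpha_0<\alpha_1<\cdots$ in $\omega$ such that for each $n\in\omega$ the set $\{\langle m_{i,\alpha_n},m_{i,\alpha_n+1},\dots,m_{i,\alpha_{n+1}-1}\rangle:i\in\omega\}\setminus\{\vec 0\}$ is empty or is the set of rows of a finite image partition regular matrix which is a first entries matrix. Let $C=(c_{i,t})$ be an $\omega\times\omega$ segmented first entries matrix and, for each $t<\omega$, let $B_t$ be a $u_t\times v_t$ image partition regular matrix with rational entries ($u_t,v_t\ge 1$), with rows $\vec b^{(t)}_0,\dots,\vec b^{(t)}_{u_t-1}$. Let $D$ be any insertion matrix of $\langle B_t\rangle_{t<\omega}$ into $C$, that is, any $\omega\times\omega$ matrix whose rows are precisely all the rows of the form $$c_{i,0}\cdot\vec b^{(0)}_{j(0)}\frown c_{i,1}\cdot\vec b^{(1)}_{j(1)}\frown\cdots$$ with $i<\omega$ and $j\in\prod_{t<\omega}\{0,\dots,u_t-1\}$. Then $D$ is centrally image partition regular near zero over $S$: for every $E\subseteq S$ which is central near zero there is $\vec x\in S^\omega$ such that all entries of $D\vec x$ lie in $E$. -/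

import Mathlib

/-! ### Finite matrices -/

/-- A finite rational matrix `A` is image partition regular: whenever the positive integers are
coloured with finitely many colours, there is a vector `x` of positive integers such that all
entries of `A x` are positive integers of one and the same colour. -/
def IsImagePartitionRegular {p q : ℕ} (A : Matrix (Fin p) (Fin q) ℚ) : Prop :=
  ∀ (r : ℕ) (χ : ℕ+ → Fin r), ∃ (x : Fin q → ℕ+) (k : Fin r),
    ∀ i, ∃ n : ℕ+, χ n = k ∧ A.mulVec (fun j => ((x j : ℕ) : ℚ)) i = ((n : ℕ) : ℚ)

/-- A finite rational matrix is a first entries matrix: no row is zero, and there are positive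
rationals `d l`, one for each column, such that every row whose first nonzero entry is in
column `l` has the value `d l` there. -/
def IsFirstEntries {p q : ℕ} (A : Matrix (Fin p) (Fin q) ℚ) : Prop :=
  (∀ i, A i ≠ 0) ∧
    ∃ d : Fin q → ℚ, (∀ l, 0 < d l) ∧
      ∀ i l, A i l ≠ 0 → (∀ k, k < l → A i k = 0) → A i l = d l

/-! ### Infinite matrices -/

/-- The set of nonzero rows of the submatrix of `M` formed by the columns
`a, a + 1, …, b - 1`. -/
def nonzeroBlockRows (M : Matrix ℕ ℕ ℚ) (a b : ℕ) : Set (Fin (b - a) → ℚ) :=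
  Set.range (fun (i : ℕ) (s : Fin (b - a)) => M i (a + s)) \ {0}

/-- An `ω × ω` rational matrix is a segmented first entries matrix: no row is zero, each row has
only finitely many nonzero entries, and the columns can be cut into consecutive finite blocks such
that the set of nonzero rows of each block is empty or is the set of rows of a finite image
partition regular matrix which is a first entries matrix. -/
def IsSegmentedFirstEntries (M : Matrix ℕ ℕ ℚ) : Prop :=
  (∀ i, M i ≠ 0) ∧
  (∀ i, {j | M i j ≠ 0}.Finite) ∧
  ∃ α : ℕ → ℕ, StrictMono α ∧ α 0 = 0 ∧
    ∀ n, nonzeroBlockRows M (α n) (α (n + 1)) = ∅ ∨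
      ∃ (p : ℕ) (A : Matrix (Fin p) (Fin (α (n + 1) - α n)) ℚ),
        IsImagePartitionRegular A ∧ IsFirstEntries A ∧
          Set.range A.row = nonzeroBlockRows M (α n) (α (n + 1))

/-- `ρ` is the concatenation `w 0 ⌢ w 1 ⌢ w 2 ⌢ ⋯` of the finite vectors `w t` of lengths `v t`:
the entry `s` of `w t` stands at the place `v 0 + ⋯ + v (t - 1) + s`. (For positive lengths
every place is reached exactly once.) -/
def IsConcat (v : ℕ → ℕ) (w : ∀ t, Fin (v t) → ℚ) (ρ : ℕ → ℚ) : Prop :=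
  ∀ (t : ℕ) (s : Fin (v t)), ρ ((∑ r ∈ Finset.range t, v r) + s) = w t s

/-- `D` is an insertion matrix of the finite matrices `B t` into `C`: the rows of `D` are precisely
all the rows `C i 0 • (row j 0 of B 0) ⌢ C i 1 • (row j 1 of B 1) ⌢ ⋯`, where `i` ranges over the
rows of `C` and `j` over all choices of a row of each `B t`. -/
def IsInsertionMatrix {u v : ℕ → ℕ} (B : ∀ t, Matrix (Fin (u t)) (Fin (v t)) ℚ)
    (C D : Matrix ℕ ℕ ℚ) : Prop :=
  Set.range D.row =
    {ρ | ∃ (i : ℕ) (j : ∀ t, Fin (u t)), IsConcat v (fun t => C i t • B t (j t)) ρ}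

/-! ### Central sets near zero

Points of the Stone–Čech compactification of the discrete semigroup `S` are the ultrafilters
on `S`, with Mathlib's addition: `A ∈ p + q ↔ {x | {y | x + y ∈ A} ∈ q} ∈ p`. -/

attribute [local instance] Ultrafilter.add

/-- `O⁺(S)`: the ultrafilters on `S` that contain `S ∩ (0, ε)` for every `ε > 0`
(used for `S ⊆ (0, ∞)`). -/
def nearZero (S : AddSubsemigroup ℝ) : Set (Ultrafilter S) :=
  {p | ∀ ε : ℝ, 0 < ε → {s : S | (s : ℝ) ∈ Set.Ioo 0 ε} ∈ p}

/-- `p` is a minimal idempotent of `O⁺(S)`, for the order `q ≤ p ↔ q + p = q ∧ p + q = q` on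
idempotents. -/
def IsMinimalIdempotentNearZero (S : AddSubsemigroup ℝ) (p : Ultrafilter S) : Prop :=
  p ∈ nearZero S ∧ p + p = p ∧
    ∀ q ∈ nearZero S, q + q = q → q + p = q → p + q = q → q = p

/-- A subset of `S` is central near zero if it belongs to some minimal idempotent of `O⁺(S)`. -/
def IsCentralNearZero (S : AddSubsemigroup ℝ) (A : Set S) : Prop :=
  ∃ p : Ultrafilter S, IsMinimalIdempotentNearZero S p ∧ A ∈ p

/-- A subset of `S` is central* near zero if it belongs to every minimal idempotent
of `O⁺(S)`. -/
def IsCentralStarNearZero (S : AddSubsemigroup ℝ) (A : Set S) : Prop :=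
  ∀ p : Ultrafilter S, IsMinimalIdempotentNearZero S p → A ∈ p

/-- The subset `c S = {c s : s ∈ S}` of `S` (used for positive integers `c`). -/
def dilate (S : AddSubsemigroup ℝ) (c : ℕ) : Set S :=
  {s | ∃ t : S, (s : ℝ) = (c : ℝ) * (t : ℝ)}

/-- The `ω × ω` rational matrix `A` is centrally image partition regular near zero over `S`: for
every set `E` central near zero in `S` there is `x ∈ S^ω` such that all entries of `A x` lie
in `E`. For `S ⊆ (0, ∞)` a row with infinitely many nonzero entries makes the finite-support sum
below equal to `0`, which is not in `E`, so such a row is never accepted. -/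
def IsCentrallyImagePartitionRegularNearZero (S : AddSubsemigroup ℝ)
    (A : Matrix ℕ ℕ ℚ) : Prop :=
  ∀ E : Set S, IsCentralNearZero S E →
    ∃ x : ℕ → S, ∀ i, ∃ e ∈ E, ∑ᶠ j, (A i j : ℝ) * (x j : ℝ) = (e : ℝ)

/-!
Let `P` be a minimal idempotent of `O⁺(S)`, regarded as an ultrafilter on `ℝ`. Two facts reduce the
theorem to a statement about finite matrices. The rows of `D` split along the blocks of columns
of `C` into finitely many nonzero pieces, each being a row of the insertion of finitely many `B t`
into a finite first entries matrix. And since `P` is idempotent, if each of these finite insertions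
has an image in every member of `P`, the images can be chosen successively so that all sums of
values from different blocks lie in a prescribed member of `P`
(`exists_sums_mem_of_idempotent`).

For the finite insertions, an image partition regular matrix `B` is first factored: there is a
nonnegative rational matrix `H` without zero rows such that `B * H` is a first entries matrix
(`IsImagePartitionRegular.exists_leading`). This comes from colouring the positive integers by
the logarithm to a base close to `1` and solving, with Farkas' lemma, the linear systems that
describe the successive size classes of a monochromatic image. First entries matrices are stable
under insertion, so only they remain to be treated. Vectors with entries in `c S`, for a common
denominator `c` of the `H`, are carried by `H` to vectors over `S`; here the hypothesis that `c S`
is central* is used.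

For a finite first entries matrix, `IsMinimalIdempotentAtZero.exists_ultrafilter` produces one
ultrafilter on the space of vectors that all rows map to `P` itself, by induction on the number of
columns. The ultrafilters that the rows vanishing in the new first column map to `P`, and that the
other rows map to ultrafilters near zero, form a closed semigroup `I`. It is an ideal
relative to the copy `pt` of `P` on the axis of the new coordinate, hence it contains an idempotent
below `pt` (`exists_idempotent_below`). The rows with a nonzero entry in the first column map `pt`
to `P` and this idempotent to an idempotent below `P`, which is `P` by minimality.
-/

/-! ### Cones over the rationals -/

/-- Farkas' lemma, by Bartl's induction on the number of generators: if the functional found for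
the generators `c 1, …, c n` is negative at `c 0`, project along `c 0` onto its kernel. -/
theorem exists_nonneg_combination_or_separating {V : Type*} [AddCommGroup V] [Module ℚ V] (n : ℕ) :
    ∀ (c : Fin n → V) (w : V), (∃ h : Fin n → ℚ, (∀ j, 0 ≤ h j) ∧ ∑ j, h j • c j = w) ∨
      ∃ f : Module.Dual ℚ V, (∀ j, 0 ≤ f (c j)) ∧ f w < 0 := by
  induction n with
  | zero =>
    intro c w
    by_cases hw : w = 0
    · exact Or.inl ⟨fun _ => 0, fun _ => le_rfl, by simp [hw]⟩
    · right
      obtain ⟨f, hf⟩ : ∃ f : Module.Dual ℚ V, f w ≠ 0 := by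
        by_contra! hcon
        exact hw ((Module.forall_dual_apply_eq_zero_iff ℚ w).1 hcon)
      rcases lt_or_gt_of_ne hf with h | h
      · exact ⟨f, fun j => j.elim0, h⟩
      · exact ⟨-f, fun j => j.elim0, by simpa using h⟩
  | succ n ih =>
    intro c w
    rcases ih (fun j => c j.succ) w with ⟨h, h0, hw⟩ | ⟨f, hf, hfw⟩
    · refine Or.inl ⟨Fin.cons 0 h, fun j => ?_, by simp [Fin.sum_univ_succ, hw]⟩
      induction j using Fin.cases with
      | zero => simp
      | succ j => simpa using h0 j
    rcases le_or_gt 0 (f (c 0)) with h0 | h0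
    · refine Or.inr ⟨f, fun j => ?_, hfw⟩
      induction j using Fin.cases with
      | zero => exact h0
      | succ j => exact hf j
    let π : V →ₗ[ℚ] V := LinearMap.id - (f.smulRight ((f (c 0))⁻¹ • c 0))
    have hπ : ∀ x, π x = x - (f x / f (c 0)) • c 0 := fun x => by
      simp [π, smul_smul, div_eq_mul_inv]
    rcases ih (fun j => π (c j.succ)) (π w) with ⟨h, hh, hw⟩ | ⟨g, hg, hgw⟩
    · left
      refine ⟨Fin.cons (f w / f (c 0) - ∑ j, h j * (f (c j.succ) / f (c 0))) h, fun j => ?_, ?_⟩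
      · induction j using Fin.cases with
        | zero =>
          have h1 : 0 ≤ f w / f (c 0) := (div_pos_of_neg_of_neg hfw h0).le
          have h2 : ∑ j, h j * (f (c j.succ) / f (c 0)) ≤ 0 := Finset.sum_nonpos fun j _ =>
            mul_nonpos_of_nonneg_of_nonpos (hh j) (div_nonpos_of_nonneg_of_nonpos (hf j) h0.le)
          simp only [Fin.cons_zero]
          linarith
        | succ j => simpa using hh j
      · simp only [hπ, smul_sub, Finset.sum_sub_distrib, smul_smul, ← Finset.sum_smul] at hw
        simp only [Fin.sum_univ_succ, Fin.cons_zero, Fin.cons_succ, sub_smul]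
        rw [sub_eq_sub_iff_add_eq_add] at hw
        rw [sub_add_eq_add_sub, sub_eq_iff_eq_add, add_comm, hw]
    · refine Or.inr ⟨g.comp π, fun j => ?_, hgw⟩
      induction j using Fin.cases with
      | zero => simp [hπ, div_self h0.ne]
      | succ j => exact hg j

/-- A finitely generated rational cone is closed. -/
theorem exists_nonneg_combination_of_approx {ι : Type*} [Fintype ι] [DecidableEq ι] {n : ℕ}
    (c : Fin n → ι → ℚ) (w : ι → ℚ) :
    ∃ ε : ℚ, 0 < ε ∧ ∀ h : Fin n → ℚ, (∀ j, 0 ≤ h j) → (∀ i, |∑ j, h j * c j i - w i| ≤ ε) →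
      ∃ h : Fin n → ℚ, (∀ j, 0 ≤ h j) ∧ ∀ i, ∑ j, h j * c j i = w i := by
  rcases exists_nonneg_combination_or_separating n c w with ⟨h, h0, hw⟩ | ⟨f, hf, hfw⟩
  · refine ⟨1, one_pos, fun _ _ _ => ⟨h, h0, fun i => ?_⟩⟩
    simpa using congrFun hw i
  set e : ι → ℚ := fun i => f (Pi.single i 1)
  have hfe : ∀ x : ι → ℚ, f x = ∑ i, x i * e i := fun x => by
    conv_lhs => rw [pi_eq_sum_univ' x]
    simp [map_sum, e, Pi.single]
  have hM : 0 < 1 + ∑ i, |e i| := by positivity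
  refine ⟨-f w / (1 + ∑ i, |e i|), div_pos (by linarith) hM, fun h h0 hh => ?_⟩
  exfalso
  set ε := -f w / (1 + ∑ i, |e i|) with hε
  have hεM : ε * (1 + ∑ i, |e i|) = -f w := div_mul_cancel₀ _ hM.ne'
  have hε0 : 0 < ε := div_pos (by linarith) hM
  have h1 : 0 ≤ f (∑ j, h j • c j) := by
    rw [map_sum]
    exact Finset.sum_nonneg fun j _ => by simpa using mul_nonneg (h0 j) (hf j)
  have h2 : f ((∑ j, h j • c j) - w) ≤ ε * ∑ i, |e i| := by
    rw [hfe, Finset.mul_sum]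
    refine Finset.sum_le_sum fun i _ => (le_abs_self _).trans ?_
    rw [abs_mul]
    refine mul_le_mul_of_nonneg_right ?_ (abs_nonneg _)
    simpa using hh i
  rw [map_sub] at h2
  linarith

/-- For a fixed matrix `B`, all systems prescribing the value `1` on a set `T` of rows and `0` on
the rest of a set `R` of rows are uniformly stable: an approximate nonnegative solution within a
suitable `ε` yields an exact one. -/
theorem exists_uniform_solvability {p q : ℕ} (B : Matrix (Fin p) (Fin q) ℚ) :
    ∃ ε : ℚ, 0 < ε ∧ ∀ (R T : Finset (Fin p)), T ⊆ R →
      (∃ x : Fin q → ℚ, (∀ j, 0 ≤ x j) ∧ (∀ i ∈ T, |B.mulVec x i - 1| ≤ ε) ∧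
        ∀ i ∈ R \ T, |B.mulVec x i| ≤ ε) →
      ∃ x : Fin q → ℚ, (∀ j, 0 ≤ x j) ∧ (∀ i ∈ T, B.mulVec x i = 1) ∧
        ∀ i ∈ R \ T, B.mulVec x i = 0 := by
  choose e he hs using fun RT : Finset (Fin p) × Finset (Fin p) =>
    exists_nonneg_combination_of_approx (fun j i => if i ∈ RT.1 then B i j else 0)
      (fun i => if i ∈ RT.2 then 1 else 0)
  obtain ⟨m, hm⟩ := Finite.exists_min e
  have key : ∀ (x : Fin q → ℚ) (R : Finset (Fin p)) (i : Fin p),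
      ∑ j, x j * (if i ∈ R then B i j else 0) = if i ∈ R then B.mulVec x i else 0 := by
    intro x R i
    split_ifs
    · exact Finset.sum_congr rfl fun j _ => mul_comm _ _
    · simp
  refine ⟨e m, he m, fun R T hTR ⟨x, hx0, hxT, hxR⟩ => ?_⟩
  obtain ⟨h, h0, hh⟩ := hs (R, T) x hx0 fun i => by
    rw [key]
    refine le_trans ?_ (hm (R, T))
    dsimp only
    by_cases hT : i ∈ T
    · simpa [hT, hTR hT] using hxT i hT
    by_cases hR : i ∈ R
    · simpa [hT, hR] using hxR i (by simp [hT, hR])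
    · simpa [hT, hR] using (he m).le
  refine ⟨h, h0, fun i hi => ?_, fun i hi => ?_⟩
  · have := hh i
    rw [key] at this
    simpa [hi, hTR hi] using this
  · rw [Finset.mem_sdiff] at hi
    have := hh i
    rw [key] at this
    simpa [hi.1, hi.2] using this

/-! ### Image partition regular matrices factor through first entries matrices -/

/-- Colour `n` by the residue of `⌊log n⌋` to the base `1 + ε`, modulo a large number. -/
theorem exists_coloring_near_or_far (ε : ℚ) (hε : 0 < ε) :
    ∃ (r : ℕ) (χ : ℕ+ → Fin r), ∀ a b : ℕ+, χ a = χ b → a ≤ b →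
      (1 - ε) * ((b : ℕ) : ℚ) ≤ ((a : ℕ) : ℚ) ∨ ((a : ℕ) : ℚ) ≤ ε * ((b : ℕ) : ℚ) := by
  have hb : (1 : ℚ) < 1 + ε := by linarith
  obtain ⟨N, hN⟩ := pow_unbounded_of_one_lt (1 / ε) hb
  have h1 : ∀ n : ℕ+, (1 : ℚ) ≤ ((n : ℕ) : ℚ) := fun n => by exact_mod_cast (one_le : 1 ≤ n)
  choose k hk hk' using fun n : ℕ+ => exists_nat_pow_near (h1 n) hb
  refine ⟨N + 1, fun n => ⟨k n % (N + 1), Nat.mod_lt _ N.succ_pos⟩, fun a b hab hle => ?_⟩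
  have hmod : k a % (N + 1) = k b % (N + 1) := congrArg Fin.val hab
  have hle' : ((a : ℕ) : ℚ) ≤ ((b : ℕ) : ℚ) := by exact_mod_cast hle
  have hkle : k a ≤ k b := by
    have := (pow_lt_pow_iff_right₀ hb).1 (((hk a).trans hle').trans_lt (hk' b))
    omega
  have ha0 : (0 : ℚ) < ((a : ℕ) : ℚ) := one_pos.trans_le (h1 a)
  have hb0 : (0 : ℚ) < ((b : ℕ) : ℚ) := one_pos.trans_le (h1 b)
  rcases hkle.eq_or_lt with heq | hlt
  · left
    have h2 : ((b : ℕ) : ℚ) ≤ (1 + ε) * ((a : ℕ) : ℚ) := by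
      have := (hk' b).le
      rw [← heq, pow_succ'] at this
      exact this.trans (mul_le_mul_of_nonneg_left (hk a) (by linarith))
    rcases le_or_gt 1 ε with h | h
    · exact (mul_nonpos_of_nonpos_of_nonneg (by linarith) hb0.le).trans ha0.le
    · have := mul_le_mul_of_nonneg_left h2 (sub_nonneg.2 h.le)
      nlinarith [mul_pos (mul_pos hε hε) ha0]
  · right
    have h3 : k a + 1 + N ≤ k b := by
      obtain ⟨c, hc⟩ := (Nat.modEq_iff_dvd' hkle).1 hmod
      have : c ≠ 0 := by rintro rfl; omega
      have := Nat.le_mul_of_pos_right (N + 1) (Nat.pos_of_ne_zero this)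
      omega
    have h4 : (1 + ε) ^ (k a + 1) * (1 + ε) ^ N ≤ ((b : ℕ) : ℚ) := by
      rw [← pow_add]
      exact (pow_le_pow_right₀ hb.le h3).trans (hk b)
    have h5 : ((a : ℕ) : ℚ) * (1 / ε) ≤ ((b : ℕ) : ℚ) :=
      (mul_le_mul (hk' a).le hN.le (by positivity) (by positivity)).trans h4
    rw [mul_one_div, div_le_iff₀ hε] at h5
    linarith

/-- An image partition regular matrix `B` becomes, after a nonnegative rational change of
variables without zero rows, whose columns are the `H k`, a first entries matrix with all first
entries equal to `1` (`ℓ i` is the column of the first nonzero entry of row `i`).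

In a monochromatic image `B x = y` for the colouring by logarithms, any two entries of `y` are
nearly equal or of very different size. Dividing `x` by the largest entry nearly solves the system
asking for `1` in the rows of that size class and `0` in all smaller ones; an exact solution is a
column of `H`, and the class is then removed. A final column of ones makes every row of `H`
nonzero. -/
theorem IsImagePartitionRegular.exists_leading {p q : ℕ} {B : Matrix (Fin p) (Fin q) ℚ}
    (hB : IsImagePartitionRegular B) :
    ∃ (m : ℕ) (H : Fin m → Fin q → ℚ) (ℓ : Fin p → Fin m),
      (∀ k j, 0 ≤ H k j) ∧ (∀ j, ∃ k, 0 < H k j) ∧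
        ∀ i, B.mulVec (H (ℓ i)) i = 1 ∧ ∀ k < ℓ i, B.mulVec (H k) i = 0 := by
  obtain ⟨ε, hε, hsolve⟩ := exists_uniform_solvability B
  obtain ⟨r, χ, hχ⟩ := exists_coloring_near_or_far ε hε
  obtain ⟨x, c, hx⟩ := hB r χ
  choose y hyc hy using hx
  suffices h : ∀ R : Finset (Fin p), ∃ (m : ℕ) (H : Fin m → Fin q → ℚ) (ℓ : Fin p → Fin m),
      (∀ k j, 0 ≤ H k j) ∧ (∀ j, ∃ k, 0 < H k j) ∧
        ∀ i ∈ R, B.mulVec (H (ℓ i)) i = 1 ∧ ∀ k < ℓ i, B.mulVec (H k) i = 0 by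
    obtain ⟨m, H, ℓ, h0, h1, h2⟩ := h Finset.univ
    exact ⟨m, H, ℓ, h0, h1, fun i => h2 i (Finset.mem_univ i)⟩
  intro R
  induction R using Finset.strongInduction with
  | H R ih =>
  rcases R.eq_empty_or_nonempty with rfl | hR
  · exact ⟨1, fun _ _ => 1, fun _ => 0, fun _ _ => zero_le_one, fun _ => ⟨0, one_pos⟩,
      fun i hi => by simp at hi⟩
  obtain ⟨i₀, hi₀, hmax⟩ := R.exists_max_image y hR
  set M : ℚ := ((y i₀ : ℕ) : ℚ) with hM
  have hM0 : 0 < M := Nat.cast_pos.2 (y i₀).pos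
  classical
  let T : Finset (Fin p) := insert i₀ (R.filter fun i => (1 - ε) * M ≤ ((y i : ℕ) : ℚ))
  have hTR : T ⊆ R := Finset.insert_subset hi₀ (Finset.filter_subset _ _)
  have hle : ∀ i ∈ R, ((y i : ℕ) : ℚ) ≤ M := fun i hi => Nat.cast_le.2 (hmax i hi)
  have hdiv : ∀ i, B.mulVec (fun j => ((x j : ℕ) : ℚ) / M) i = ((y i : ℕ) : ℚ) / M := fun i => by
    rw [← hy i]
    simp [Matrix.mulVec, dotProduct, Finset.sum_div, mul_div_assoc]
  obtain ⟨h, h0, hT, hRT⟩ := hsolve R T hTR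
    ⟨fun j => ((x j : ℕ) : ℚ) / M, fun j => by positivity, fun i hi => by
      rw [hdiv, abs_le]
      have h2 : ((y i : ℕ) : ℚ) / M ≤ 1 := (div_le_one hM0).2 (hle i (hTR hi))
      have h1 : 1 - ε ≤ ((y i : ℕ) : ℚ) / M := by
        rcases Finset.mem_insert.1 hi with rfl | hi
        · rw [← hM, div_self hM0.ne']
          linarith
        · rw [le_div_iff₀ hM0]
          exact (Finset.mem_filter.1 hi).2
      constructor <;> linarith, fun i hi => by
      rw [Finset.mem_sdiff] at hi
      rw [hdiv, abs_of_nonneg (by positivity), div_le_iff₀ hM0]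
      refine (hχ (y i) (y i₀) ((hyc i).trans (hyc i₀).symm) (hmax i hi.1)).resolve_left
        fun hcon => hi.2 ?_
      exact Finset.mem_insert_of_mem (Finset.mem_filter.2 ⟨hi.1, hcon⟩)⟩
  obtain ⟨m, H, ℓ, hH0, hH1, hℓ⟩ := ih (R \ T) (Finset.sdiff_ssubset hTR ⟨i₀, by simp [T]⟩)
  refine ⟨m + 1, Fin.cons h H, fun i => if i ∈ T then 0 else (ℓ i).succ, fun k j => ?_,
    fun j => ?_, fun i hi => ?_⟩
  · induction k using Fin.cases with
    | zero => exact h0 j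
    | succ k => exact hH0 k j
  · obtain ⟨k, hk⟩ := hH1 j
    exact ⟨k.succ, hk⟩
  · by_cases hiT : i ∈ T
    · simpa [hiT] using hT i hiT
    · have hi' : i ∈ R \ T := Finset.mem_sdiff.2 ⟨hi, hiT⟩
      simp only [hiT, if_false, Fin.cons_succ]
      refine ⟨(hℓ i hi').1, fun k hk => ?_⟩
      induction k using Fin.cases with
      | zero => exact hRT i hi'
      | succ k => exact (hℓ i hi').2 k (Fin.succ_lt_succ_iff.1 hk)

/-! ### First entries systems and minimal idempotents -/

attribute [local instance] Ultrafilter.addSemigroup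

theorem Ultrafilter.map_add_of_additive {M N : Type*} [Add M] [Add N] (f : M → N)
    (hf : ∀ x y, f (x + y) = f x + f y) (U V : Ultrafilter M) :
    (U + V).map f = U.map f + V.map f := by
  refine Ultrafilter.ext fun s => ?_
  change (∀ᶠ x in (U : Filter M), ∀ᶠ y in (V : Filter M), f (x + y) ∈ s) ↔
    ∀ᶠ x in (U : Filter M), ∀ᶠ y in (V : Filter M), f x + f y ∈ s
  simp only [hf]

/-- `P` is (the image in the ultrafilters on the real line of) a minimal idempotent of `O⁺(S)`.
Working on `ℝ` instead of `S` makes rational linear maps available. -/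
structure IsMinimalIdempotentAtZero (S : AddSubsemigroup ℝ) (P : Ultrafilter ℝ) : Prop where
  small : ∀ ε : ℝ, 0 < ε → ∀ᶠ x in (P : Filter ℝ), x ∈ S ∧ x < ε
  idem : P + P = P
  eq_of_le : ∀ Q : Ultrafilter ℝ, (∀ ε : ℝ, 0 < ε → ∀ᶠ x in (Q : Filter ℝ), x ∈ S ∧ x < ε) →
    Q + Q = Q → Q + P = Q → P + Q = Q → Q = P

theorem IsMinimalIdempotentNearZero.map_coe {S : AddSubsemigroup ℝ} (hS : ∀ s ∈ S, 0 < s)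
    {p : Ultrafilter S} (hp : IsMinimalIdempotentNearZero S p) :
    IsMinimalIdempotentAtZero S (p.map ((↑) : S → ℝ)) := by
  have hadd : ∀ q q' : Ultrafilter S, (q + q').map ((↑) : S → ℝ) =
      q.map ((↑) : S → ℝ) + q'.map ((↑) : S → ℝ) :=
    Ultrafilter.map_add_of_additive _ fun _ _ => rfl
  have hinj : Function.Injective (Ultrafilter.map ((↑) : S → ℝ)) := fun q q' h =>
    Ultrafilter.coe_injective (Filter.map_injective Subtype.val_injective
      (by simpa using congrArg (fun u : Ultrafilter ℝ => (u : Filter ℝ)) h))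
  refine ⟨fun ε hε => ?_, by rw [← hadd, hp.2.1], fun Q hQ hQQ hQp hpQ => ?_⟩
  · have : {s : S | (s : ℝ) ∈ Set.Ioo 0 ε} ∈ p := hp.1 ε hε
    change ∀ᶠ s : S in (p : Filter S), (s : ℝ) ∈ S ∧ (s : ℝ) < ε
    filter_upwards [this] with s hs using ⟨s.2, hs.2⟩
  · have hr : Set.range ((↑) : S → ℝ) ∈ Q := by
      filter_upwards [hQ 1 one_pos] with x hx using ⟨⟨x, hx.1⟩, rfl⟩
    obtain ⟨q, rfl⟩ : ∃ q : Ultrafilter S, q.map ((↑) : S → ℝ) = Q := by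
      refine ⟨Q.comap Subtype.val_injective hr, Ultrafilter.coe_injective ?_⟩
      simpa using Filter.map_comap_of_mem hr
    rw [← hadd] at hQQ hQp hpQ
    refine congrArg _ (hp.2.2 q (fun ε hε => ?_) (hinj hQQ) (hinj hQp) (hinj hpQ))
    have := hQ ε hε
    change ∀ᶠ s : S in (q : Filter S), (s : ℝ) ∈ S ∧ (s : ℝ) < ε at this
    filter_upwards [this] with s hs using ⟨hS _ hs.1, hs.2⟩

/-- The submonoid `S ∪ {0}`. -/
def AddSubsemigroup.adjoinZero (S : AddSubsemigroup ℝ) : AddSubmonoid ℝ where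
  carrier := {x | x = 0 ∨ x ∈ S}
  zero_mem' := Or.inl rfl
  add_mem' := by
    rintro a b (rfl | ha) (rfl | hb)
    · simp
    · simpa using Or.inr hb
    · simpa using Or.inr ha
    · exact Or.inr (add_mem ha hb)

theorem AddSubsemigroup.mem_adjoinZero {S : AddSubsemigroup ℝ} {x : ℝ} (hx : x ∈ S) :
    x ∈ S.adjoinZero := Or.inr hx

theorem AddSubsemigroup.add_mem_of_adjoinZero {S : AddSubsemigroup ℝ} {x y : ℝ} (hx : x ∈ S)
    (hy : y ∈ S.adjoinZero) : x + y ∈ S := by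
  rcases hy with rfl | hy
  · simpa using hx
  · exact add_mem hx hy

theorem AddSubsemigroup.natCast_mul_mem {S : AddSubsemigroup ℝ} {n : ℕ} (hn : 0 < n) {x : ℝ}
    (hx : x ∈ S) : (n : ℝ) * x ∈ S := by
  obtain ⟨k, rfl⟩ := Nat.exists_eq_succ_of_ne_zero hn.ne'
  have h : ((k + 1 : ℕ) : ℝ) * x = x + k • x := by
    rw [nsmul_eq_mul]; push_cast; ring
  rw [h]
  exact add_mem_of_adjoinZero hx (nsmul_mem (mem_adjoinZero hx) k)

theorem exists_common_denominator {ι : Type*} [Finite ι] (q : ι → ℚ) (hq : ∀ i, 0 ≤ q i) :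
    ∃ N : ℕ, 0 < N ∧ ∀ i, ∃ n : ℕ, (N : ℚ) * q i = n := by
  have := Fintype.ofFinite ι
  refine ⟨∏ i, (q i).den, Finset.prod_pos fun i _ => (q i).den_pos, fun i => ?_⟩
  obtain ⟨k, hk⟩ := Finset.dvd_prod_of_mem (fun i => (q i).den) (Finset.mem_univ i)
  refine ⟨k * (q i).num.toNat, ?_⟩
  have h1 : (((q i).num.toNat : ℕ) : ℚ) = (q i).num := by
    exact_mod_cast Int.toNat_of_nonneg (Rat.num_nonneg.2 (hq i))
  rw [hk]
  push_cast
  rw [h1]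
  have := Rat.mul_den_eq_num (q i)
  linear_combination (k : ℚ) * this

/-- `w` is a vector with entries in `c S` that are less than `ε`. -/
def IsSmallMultiple (S : AddSubsemigroup ℝ) (c : ℕ) (ε : ℝ) {m : ℕ} (w : Fin m → ℝ) : Prop :=
  ∀ k, (∃ t ∈ S, w k = c * t) ∧ w k < ε

/-- If the ultrafilter `pt` is idempotent and `I` is a nonempty closed semigroup of ultrafilters
stable under adding `pt` on both sides, then `I` contains an idempotent below `pt`. -/
theorem exists_idempotent_below {M : Type*} [AddSemigroup M] (I : Set (Ultrafilter M))
    (hI : IsClosed I) (hne : I.Nonempty) (pt : Ultrafilter M) (hpt : pt + pt = pt)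
    (hII : ∀ z ∈ I, ∀ z' ∈ I, z + z' ∈ I) (hIp : ∀ z ∈ I, z + pt ∈ I)
    (hpI : ∀ z ∈ I, pt + z ∈ I) : ∃ e ∈ I, e + e = e ∧ e + pt = e ∧ pt + e = e := by
  obtain ⟨z₀, hz₀⟩ := hne
  obtain ⟨e₀, ⟨z, hz, rfl⟩, he⟩ := exists_idempotent_in_compact_add_subsemigroup
    (Ultrafilter.continuous_add_left) ((fun z => z + pt) '' I) ⟨_, z₀, hz₀, rfl⟩
    (hI.isCompact.image (Ultrafilter.continuous_add_left pt)) (by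
      rintro _ ⟨z, hz, rfl⟩ _ ⟨z', hz', rfl⟩
      exact ⟨z + pt + z', hII _ (hIp z hz) _ hz', add_assoc _ _ _⟩)
  set e₀ := z + pt with he₀
  have h1 : e₀ + pt = e₀ := by rw [he₀, add_assoc, hpt]
  refine ⟨pt + e₀, hpI _ (hIp z hz), ?_, ?_, ?_⟩
  · rw [add_assoc, ← add_assoc e₀, h1, he]
  · rw [add_assoc, h1]
  · rw [← add_assoc, hpt]

/-- The value of the rational linear form with coefficients `a` at the real vector `w`. -/
def rowEval {m : ℕ} (a : Fin m → ℚ) (w : Fin m → ℝ) : ℝ := ∑ k, (a k : ℝ) * w k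

theorem rowEval_add {m : ℕ} (a : Fin m → ℚ) (w w' : Fin m → ℝ) :
    rowEval a (w + w') = rowEval a w + rowEval a w' := by
  simp [rowEval, mul_add, Finset.sum_add_distrib]

theorem rowEval_cons {m : ℕ} (a : Fin (m + 1) → ℚ) (x : ℝ) (w : Fin m → ℝ) :
    rowEval a (Fin.cons x w : Fin (m + 1) → ℝ) = a 0 * x + rowEval (fun k => a k.succ) w := by
  simp [rowEval, Fin.sum_univ_succ]

theorem rowEval_lt {m : ℕ} (a : Fin m → ℚ) {ε : ℝ} (hε : 0 < ε) :
    ∃ δ : ℝ, 0 < δ ∧ ∀ w : Fin m → ℝ, (∀ k, 0 < w k ∧ w k < δ) → rowEval a w < ε := by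
  have hM : 0 < 1 + ∑ k, |(a k : ℝ)| := by positivity
  refine ⟨ε / (1 + ∑ k, |(a k : ℝ)|), by positivity, fun w hw => ?_⟩
  set δ := ε / (1 + ∑ k, |(a k : ℝ)|) with hδ
  have h1 : rowEval a w ≤ ∑ k, |(a k : ℝ)| * δ := Finset.sum_le_sum fun k _ =>
    (mul_le_mul_of_nonneg_right (le_abs_self _) (hw k).1.le).trans
      (mul_le_mul_of_nonneg_left (hw k).2.le (abs_nonneg _))
  have h2 : δ * (1 + ∑ k, |(a k : ℝ)|) = ε := div_mul_cancel₀ _ hM.ne'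
  have h3 : 0 < δ := by positivity
  rw [← Finset.sum_mul] at h1
  linarith

/-- The inductive step of `IsMinimalIdempotentAtZero.exists_ultrafilter`, in which the column `0`
is added. The predicate `lead` singles out the rows with a nonzero entry there, `pt` is the copy of
`P` on the axis of this column, and `z₀` is a first approximation that the other rows already map
to `P`. -/
theorem IsMinimalIdempotentAtZero.exists_ultrafilter_succ {S : AddSubsemigroup ℝ}
    (hS : ∀ s ∈ S, 0 < s) {P : Ultrafilter ℝ} (hP : IsMinimalIdempotentAtZero S P)
    {m : ℕ} {ι : Type*} (A : ι → Fin (m + 1) → ℚ) (lead : ι → Prop) {d : ℚ} (hd : 0 < d)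
    (hA1 : ∀ i, lead i → A i 0 = d) (hA0 : ∀ i, ¬ lead i → A i 0 = 0) {c : ℕ}
    (hc0 : 0 < c) (pt z₀ : Ultrafilter (Fin (m + 1) → ℝ))
    (hpt : pt = P.map fun x => (Fin.cons (x / (d : ℝ)) 0 : Fin (m + 1) → ℝ))
    (hc : ∀ᶠ x in (P : Filter ℝ), ∃ t ∈ S, x / (d : ℝ) = c * t)
    (hz₀ : ∀ ε : ℝ, 0 < ε → ∀ᶠ w in (z₀ : Filter (Fin (m + 1) → ℝ)), IsSmallMultiple S c ε w)
    (hz₀0 : ∀ i, ¬ lead i → z₀.map (rowEval (A i)) = P)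
    (hz₀1 : ∀ i, lead i → ∀ᶠ w in (z₀ : Filter (Fin (m + 1) → ℝ)), rowEval (A i) w ∈ S) :
    ∃ z : Ultrafilter (Fin (m + 1) → ℝ),
      (∀ ε : ℝ, 0 < ε → ∀ᶠ w in (z : Filter (Fin (m + 1) → ℝ)), IsSmallMultiple S c ε w) ∧
        ∀ i, z.map (rowEval (A i)) = P := by
  have hdR : (0 : ℝ) < d := by exact_mod_cast hd
  let I : Set (Ultrafilter (Fin (m + 1) → ℝ)) := {z |
    (∀ ε : ℝ, 0 < ε → ∀ᶠ w in (z : Filter (Fin (m + 1) → ℝ)), IsSmallMultiple S c ε w) ∧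
    (∀ i, ¬ lead i → z.map (rowEval (A i)) = P) ∧
    ∀ i, lead i → ∀ᶠ w in (z : Filter (Fin (m + 1) → ℝ)), rowEval (A i) w ∈ S}
  -- `J` contains both `I` and `pt`, and adding an element of `J` on either side preserves `I`.
  let J : Set (Ultrafilter (Fin (m + 1) → ℝ)) := {z |
    (∀ ε : ℝ, 0 < ε → ∀ᶠ w in (z : Filter (Fin (m + 1) → ℝ)),
      ∀ k, (∃ t ∈ S.adjoinZero, w k = c * t) ∧ w k < ε) ∧
    (∀ i, ¬ lead i → z.map (rowEval (A i)) = P ∨ z.map (rowEval (A i)) = pure 0) ∧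
    ∀ i, lead i → ∀ᶠ w in (z : Filter (Fin (m + 1) → ℝ)), rowEval (A i) w ∈ S}
  have hIJ : I ⊆ J := fun z hz => ⟨fun ε hε => (hz.1 ε hε).mono fun w hw k => by
    obtain ⟨⟨t, ht, h⟩, h'⟩ := hw k
    exact ⟨⟨t, AddSubsemigroup.mem_adjoinZero ht, h⟩, h'⟩, fun i hi => Or.inl (hz.2.1 i hi), hz.2.2⟩
  have hptrow : ∀ i, pt.map (rowEval (A i)) = P.map fun x => (A i 0 : ℝ) * (x / d) := by
    intro i
    rw [hpt, Ultrafilter.map_map]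
    congr 1
    funext x
    simp [rowEval, Fin.sum_univ_succ]
  have hptrow1 : ∀ i, lead i → pt.map (rowEval (A i)) = P := by
    intro i hi
    have : (fun x : ℝ => (A i 0 : ℝ) * (x / d)) = id := by
      funext x
      rw [hA1 i hi]
      exact mul_div_cancel₀ _ hdR.ne'
    rw [hptrow, this, Ultrafilter.map_id]
  have hpureadd : ∀ U : Ultrafilter ℝ, pure 0 + U = U := fun U => Ultrafilter.ext fun s => by
    change (∀ᶠ x in ((pure 0 : Ultrafilter ℝ) : Filter ℝ), ∀ᶠ y in (U : Filter ℝ), x + y ∈ s) ↔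
      ∀ᶠ y in (U : Filter ℝ), y ∈ s
    simp
  have haddpure : ∀ U : Ultrafilter ℝ, U + pure 0 = U := fun U => Ultrafilter.ext fun s => by
    change (∀ᶠ x in (U : Filter ℝ), ∀ᶠ y in ((pure 0 : Ultrafilter ℝ) : Filter ℝ), x + y ∈ s) ↔
      ∀ᶠ y in (U : Filter ℝ), y ∈ s
    simp
  have hmapadd : ∀ (i : ι) (U V : Ultrafilter (Fin (m + 1) → ℝ)),
      (U + V).map (rowEval (A i)) = U.map (rowEval (A i)) + V.map (rowEval (A i)) :=
    fun i => Ultrafilter.map_add_of_additive _ (rowEval_add _)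
  have hptJ : pt ∈ J := by
    refine ⟨fun ε hε => ?_, fun i hi => Or.inr ?_, fun i hi => ?_⟩
    · rw [hpt]
      change ∀ᶠ x in (P : Filter ℝ), _
      filter_upwards [hc, hP.small (ε * d) (by positivity)] with x hx hx' k
      induction k using Fin.cases with
      | zero =>
        obtain ⟨t, ht, h⟩ := hx
        exact ⟨⟨t, AddSubsemigroup.mem_adjoinZero ht, h⟩, (div_lt_iff₀ hdR).2 hx'.2⟩
      | succ k => exact ⟨⟨0, zero_mem _, by simp⟩, hε⟩
    · rw [hptrow, hA0 i hi]
      refine Ultrafilter.coe_injective ?_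
      simp [Filter.map_const]
    · have : ∀ᶠ x in (pt.map (rowEval (A i)) : Filter ℝ), x ∈ S := by
        rw [hptrow1 i hi]
        exact (hP.small 1 one_pos).mono fun x hx => hx.1
      exact this
  have hIJI : ∀ z ∈ I, ∀ z' ∈ J, z + z' ∈ I := by
    intro z hz z' hz'
    refine ⟨fun ε hε => ?_, fun i hi => ?_, fun i hi => ?_⟩
    · refine (Ultrafilter.eventually_add _ _ _).2 ?_
      filter_upwards [hz.1 (ε / 2) (half_pos hε)] with w hw
      filter_upwards [hz'.1 (ε / 2) (half_pos hε)] with w' hw' k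
      obtain ⟨⟨t, ht, h⟩, hl⟩ := hw k
      obtain ⟨⟨t', ht', h'⟩, hl'⟩ := hw' k
      refine ⟨⟨t + t', AddSubsemigroup.add_mem_of_adjoinZero ht ht', ?_⟩, ?_⟩
      · rw [Pi.add_apply, h, h', mul_add]
      · rw [Pi.add_apply]; linarith
    · rw [hmapadd, hz.2.1 i hi]
      rcases hz'.2.1 i hi with h | h
      · rw [h, hP.idem]
      · rw [h, haddpure]
    · refine (Ultrafilter.eventually_add _ _ _).2 ?_
      filter_upwards [hz.2.2 i hi] with w hw
      filter_upwards [hz'.2.2 i hi] with w' hw'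
      rw [rowEval_add]
      exact add_mem hw hw'
  have hJII : ∀ z ∈ J, ∀ z' ∈ I, z + z' ∈ I := by
    intro z hz z' hz'
    refine ⟨fun ε hε => ?_, fun i hi => ?_, fun i hi => ?_⟩
    · refine (Ultrafilter.eventually_add _ _ _).2 ?_
      filter_upwards [hz.1 (ε / 2) (half_pos hε)] with w hw
      filter_upwards [hz'.1 (ε / 2) (half_pos hε)] with w' hw' k
      obtain ⟨⟨t, ht, h⟩, hl⟩ := hw k
      obtain ⟨⟨t', ht', h'⟩, hl'⟩ := hw' k
      refine ⟨⟨t' + t, AddSubsemigroup.add_mem_of_adjoinZero ht' ht, ?_⟩, ?_⟩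
      · rw [Pi.add_apply, h, h', mul_add, add_comm]
      · rw [Pi.add_apply]; linarith
    · rw [hmapadd, hz'.2.1 i hi]
      rcases hz.2.1 i hi with h | h
      · rw [h, hP.idem]
      · rw [h, hpureadd]
    · refine (Ultrafilter.eventually_add _ _ _).2 ?_
      filter_upwards [hz.2.2 i hi] with w hw
      filter_upwards [hz'.2.2 i hi] with w' hw'
      rw [rowEval_add]
      exact add_mem hw hw'
  have hIclosed : IsClosed I := by
    have h1 : IsClosed {z : Ultrafilter (Fin (m + 1) → ℝ) | ∀ ε : ℝ, 0 < ε →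
        {w | IsSmallMultiple S c ε w} ∈ z} := by
      simp only [Set.ofPred_forall]
      exact isClosed_iInter fun _ => isClosed_iInter fun _ => ultrafilter_isClosed_basic _
    have h2 : IsClosed {z : Ultrafilter (Fin (m + 1) → ℝ) | ∀ i, ¬ lead i → ∀ s ∈ P,
        rowEval (A i) ⁻¹' s ∈ z} := by
      simp only [Set.ofPred_forall]
      exact isClosed_iInter fun _ => isClosed_iInter fun _ => isClosed_iInter fun _ =>
        isClosed_iInter fun _ => ultrafilter_isClosed_basic _
    have h3 : IsClosed {z : Ultrafilter (Fin (m + 1) → ℝ) | ∀ i, lead i →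
        {w | rowEval (A i) w ∈ S} ∈ z} := by
      simp only [Set.ofPred_forall]
      exact isClosed_iInter fun _ => isClosed_iInter fun _ => ultrafilter_isClosed_basic _
    convert h1.inter (h2.inter h3) using 1
    ext z
    refine and_congr Iff.rfl (and_congr (forall₂_congr fun i _ => ?_) Iff.rfl)
    constructor
    · intro h s hs
      rw [← h] at hs
      exact hs
    · intro h
      exact Ultrafilter.coe_le_coe.1 fun s hs => h s hs
  have hptidem : pt + pt = pt := by
    rw [hpt, ← Ultrafilter.map_add_of_additive, hP.idem]
    intro x y
    funext k
    induction k using Fin.cases with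
    | zero => simp [add_div]
    | succ k => simp
  obtain ⟨e, heI, hee, hept, hpte⟩ := exists_idempotent_below I hIclosed ⟨z₀, hz₀, hz₀0, hz₀1⟩ pt
    hptidem (fun z hz z' hz' => hIJI z hz z' (hIJ hz')) (fun z hz => hIJI z hz pt hptJ)
    fun z hz => hJII pt hptJ z hz
  refine ⟨e, heI.1, fun i => ?_⟩
  by_cases hi : lead i
  · refine hP.eq_of_le _ (fun ε hε => ?_) ?_ ?_ ?_
    · obtain ⟨δ, hδ, hrow⟩ := rowEval_lt (A i) hε
      change ∀ᶠ w in (e : Filter (Fin (m + 1) → ℝ)), _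
      filter_upwards [heI.2.2 i hi, heI.1 δ hδ] with w hw hw'
      refine ⟨hw, hrow w fun k => ⟨?_, (hw' k).2⟩⟩
      obtain ⟨t, ht, h⟩ := (hw' k).1
      rw [h]
      exact mul_pos (Nat.cast_pos.2 hc0) (hS t ht)
    · rw [← hmapadd, hee]
    · conv_lhs => rw [← hptrow1 i hi]
      rw [← hmapadd, hept]
    · conv_lhs => rw [← hptrow1 i hi]
      rw [← hmapadd, hpte]
  · exact heI.2.1 i hi

/-- For a finite matrix whose rows `A i` start in column `ℓ i` with the positive entry `d (ℓ i)`,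
some ultrafilter on the space of vectors with small entries in `c S` is mapped by every row
to `P`. -/
theorem IsMinimalIdempotentAtZero.exists_ultrafilter {S : AddSubsemigroup ℝ}
    (hS : ∀ s ∈ S, 0 < s) {P : Ultrafilter ℝ} (hP : IsMinimalIdempotentAtZero S P)
    (hdil : ∀ c : ℕ, 0 < c → ∀ᶠ x in (P : Filter ℝ), ∃ t ∈ S, x = c * t) (m : ℕ) :
    ∀ {ι : Type} [Finite ι] (A : ι → Fin m → ℚ) (ℓ : ι → Fin m) (d : Fin m → ℚ)
      (_ : ∀ k, 0 < d k) (_ : ∀ i, A i (ℓ i) = d (ℓ i)) (_ : ∀ i, ∀ k < ℓ i, A i k = 0)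
      (c : ℕ) (_ : 0 < c), ∃ z : Ultrafilter (Fin m → ℝ),
        (∀ ε : ℝ, 0 < ε → ∀ᶠ w in (z : Filter (Fin m → ℝ)), IsSmallMultiple S c ε w) ∧
          ∀ i, z.map (rowEval (A i)) = P := by
  induction m with
  | zero =>
    intro ι _ A ℓ d hd hA1 hA0 c hc
    exact ⟨pure 0, fun ε hε => Filter.Eventually.of_forall fun w k => k.elim0,
      fun i => (ℓ i).elim0⟩
  | succ m ih =>
    intro ι _ A ℓ d hd hA1 hA0 c hc
    have hdR : (0 : ℝ) < d 0 := by exact_mod_cast hd 0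
    have hcR : (0 : ℝ) < c := by exact_mod_cast hc
    -- Entries of `A` may be negative; adding `K * ∑ k, y k` to the term of the first column makes
    -- the coefficients of all `y k` positive, so that the rows take values in `S`.
    obtain ⟨K, hK⟩ : ∃ K : ℕ, ∀ i k, 0 < (K : ℚ) + A i k := by
      have hfin : (Set.range fun ik : ι × Fin (m + 1) => -A ik.1 ik.2).Finite :=
        Set.finite_range _
      obtain ⟨b, hb⟩ := hfin.bddAbove
      obtain ⟨K, hbK⟩ := exists_nat_gt b
      refine ⟨K, fun i k => ?_⟩
      have := hb ⟨(i, k), rfl⟩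
      dsimp only at this
      linarith
    obtain ⟨N, hN, hNq⟩ := exists_common_denominator
      (fun o : Option (ι × Fin (m + 1)) => o.elim (1 / (d 0 * c)) fun ik => K + A ik.1 ik.2)
      (fun o => by
        cases o with
        | none => have := hd 0; simp only [Option.elim]; positivity
        | some ik => exact (hK _ _).le)
    have hNR : (0 : ℝ) < N := by exact_mod_cast hN
    obtain ⟨n₀, hn₀⟩ := hNq none
    have hn₀R : (N : ℝ) = n₀ * (d 0 * c) := by
      have h : (N : ℚ) * (1 / (d 0 * c)) = n₀ := hn₀
      have hne : d 0 * c ≠ 0 := (mul_pos (hd 0) (by exact_mod_cast hc)).ne'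
      rw [mul_one_div, div_eq_iff hne] at h
      exact_mod_cast h
    have hn₀0 : 0 < n₀ := by
      rcases Nat.eq_zero_or_pos n₀ with h | h
      · rw [h] at hn₀R
        simp at hn₀R
        omega
      · exact h
    choose n hn using fun ik : ι × Fin (m + 1) => hNq (some ik)
    have hnR : ∀ i k, (N : ℝ) * (K + A i k) = n (i, k) := fun i k => by
      have h : (N : ℚ) * (K + A i k) = n (i, k) := hn (i, k)
      exact_mod_cast h
    have hcN : 0 < c * N := Nat.mul_pos hc hN
    obtain ⟨z, hz, hzP⟩ := ih (fun (i : {i // ℓ i ≠ 0}) k => A i k.succ)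
      (fun i => (ℓ i).pred i.2) (fun k => d k.succ) (fun k => hd _)
      (fun i => by simpa using hA1 i)
      (fun i k hk => hA0 i k.succ (by rwa [Fin.lt_pred_iff] at hk)) (c * N) hcN
    set pt : Ultrafilter (Fin (m + 1) → ℝ) :=
      P.map fun x => (Fin.cons (x / (d 0 : ℝ)) 0 : Fin (m + 1) → ℝ) with hpt
    -- The starting ultrafilter is `pt + z.map φ`: the summand `pt` makes the first coordinate
    -- positive even when `m = 0` or `K = 0`.
    let φ : (Fin m → ℝ) → (Fin (m + 1) → ℝ) :=
      fun y => Fin.cons (K * (∑ k, y k) / (d 0 : ℝ)) y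
    have hz₀ : ∀ s : Set (Fin (m + 1) → ℝ), (∀ᶠ x in (P : Filter ℝ),
        ∀ᶠ y in (z : Filter (Fin m → ℝ)),
          (Fin.cons (x / (d 0 : ℝ) + K * (∑ k, y k) / (d 0 : ℝ)) y : Fin (m + 1) → ℝ) ∈ s) →
        s ∈ pt + z.map φ := by
      intro s hs
      change ∀ᶠ x in (P : Filter ℝ), ∀ᶠ y in (z : Filter (Fin m → ℝ)),
        (Fin.cons (x / (d 0 : ℝ)) 0 : Fin (m + 1) → ℝ) + φ y ∈ s
      filter_upwards [hs] with x hx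
      filter_upwards [hx] with y hy
      convert hy using 1
      funext k
      induction k using Fin.cases with
      | zero => simp [φ]
      | succ k => simp [φ]
    refine hP.exists_ultrafilter_succ hS A (fun i => ℓ i = 0) (hd 0) (fun i hi => ?_)
      (fun i hi => hA0 i 0 (Fin.pos_of_ne_zero hi)) hc pt (pt + z.map φ) hpt ?_ ?_ ?_ ?_
    · rw [← hi, hA1]
    · filter_upwards [hdil (c * N) hcN] with x hx
      obtain ⟨t, ht, rfl⟩ := hx
      refine ⟨((c * n₀ : ℕ) : ℝ) * t,
        AddSubsemigroup.natCast_mul_mem (Nat.mul_pos hc hn₀0) ht, ?_⟩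
      rw [div_eq_iff hdR.ne']
      push_cast
      rw [hn₀R]
      ring
    · intro ε hε
      refine hz₀ _ ?_
      obtain ⟨δ, hδ, hlt⟩ := rowEval_lt (fun _ : Fin m => (K : ℚ))
        (show 0 < (ε * d 0) / 2 by positivity)
      filter_upwards [hdil (c * N) hcN, hP.small ((ε * d 0) / 2) (by positivity)] with x hx hxε
      obtain ⟨t, ht, rfl⟩ := hx
      filter_upwards [hz ε hε, hz δ hδ] with y hy hyδ k
      choose t' ht' hyt using fun k => (hy k).1
      have hpos : ∀ k, 0 < y k := fun k => by
        rw [hyt]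
        exact mul_pos (Nat.cast_pos.2 hcN) (hS _ (ht' k))
      induction k using Fin.cases with
      | zero =>
        simp only [Fin.cons_zero]
        refine ⟨⟨((c * n₀ : ℕ) : ℝ) * t + ∑ k, (K * c * n₀) • t' k,
          AddSubsemigroup.add_mem_of_adjoinZero
          (AddSubsemigroup.natCast_mul_mem (Nat.mul_pos hc hn₀0) ht)
          (sum_mem fun k _ => nsmul_mem (AddSubsemigroup.mem_adjoinZero (ht' k)) _), ?_⟩, ?_⟩
        · simp only [hyt, nsmul_eq_mul]
          rw [← Finset.mul_sum, ← Finset.mul_sum, ← add_div, div_eq_iff hdR.ne']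
          push_cast
          rw [hn₀R]
          ring
        · have h1 := hlt y fun k => ⟨hpos k, (hyδ k).2⟩
          have h2 : rowEval (fun _ : Fin m => (K : ℚ)) y = K * ∑ k, y k := by
            simp [rowEval, Finset.mul_sum]
          rw [h2] at h1
          rw [← add_div, div_lt_iff₀ hdR]
          linarith [hxε.2]
      | succ k =>
        simp only [Fin.cons_succ]
        refine ⟨⟨(N : ℝ) * t' k, AddSubsemigroup.natCast_mul_mem hN (ht' k), ?_⟩, (hy k).2⟩
        rw [hyt]
        push_cast
        ring
    · intro i hi
      rw [← hzP ⟨i, hi⟩]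
      refine Ultrafilter.coe_le_coe.1 fun s hs => ?_
      have hs' : ∀ᶠ y in (z : Filter (Fin m → ℝ)), rowEval (fun k => A i k.succ) y ∈ s := hs
      refine hz₀ _ (Filter.Eventually.of_forall fun x => hs'.mono fun y hy => ?_)
      rw [Set.mem_preimage, rowEval_cons, hA0 i 0 (Fin.pos_of_ne_zero hi)]
      simpa using hy
    · intro i hi
      refine hz₀ _ ?_
      filter_upwards [hP.small 1 one_pos] with x hx
      filter_upwards [hz 1 one_pos] with y hy
      choose t' ht' hyt using fun k => (hy k).1
      have h0 : A i 0 = d 0 := by rw [← hi, hA1]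
      have h : rowEval (A i) (Fin.cons (x / (d 0 : ℝ) + K * (∑ k, y k) / (d 0 : ℝ)) y :
          Fin (m + 1) → ℝ) = x + ∑ k, (c * n (i, k.succ)) • t' k := by
        rw [rowEval_cons, h0, ← add_div, mul_div_cancel₀ _ hdR.ne', add_assoc, rowEval,
          Finset.mul_sum, ← Finset.sum_add_distrib]
        congr 1
        refine Finset.sum_congr rfl fun k _ => ?_
        rw [nsmul_eq_mul, hyt]
        push_cast
        rw [← hnR]
        ring
      change rowEval (A i) _ ∈ S
      rw [h]
      exact AddSubsemigroup.add_mem_of_adjoinZero hx.1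
        (sum_mem fun k _ => nsmul_mem (AddSubsemigroup.mem_adjoinZero (ht' k)) _)

theorem exists_first_nonzero {n : ℕ} (a : Fin n → ℚ) (ha : a ≠ 0) :
    ∃ l, a l ≠ 0 ∧ ∀ k < l, a k = 0 := by
  obtain ⟨l, hl, hmin⟩ := WellFounded.has_min (wellFounded_lt (α := Fin n)) {l | a l ≠ 0}
    (Function.ne_iff.1 ha)
  exact ⟨l, hl, fun k hk => by_contra fun h => hmin k h hk⟩

/-- Inserting image partition regular matrices `B t` into a finite first entries matrix `A` gives
a matrix having an image in every member of `P`. After the change of variables of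
`IsImagePartitionRegular.exists_leading` in each `B t`, the inserted matrix is a first entries
matrix for the lexicographic order of the columns. -/
theorem IsMinimalIdempotentAtZero.exists_image_of_insertion {S : AddSubsemigroup ℝ}
    (hS : ∀ s ∈ S, 0 < s) {P : Ultrafilter ℝ} (hP : IsMinimalIdempotentAtZero S P)
    (hdil : ∀ c : ℕ, 0 < c → ∀ᶠ x in (P : Filter ℝ), ∃ t ∈ S, x = c * t)
    {L p : ℕ} {A : Matrix (Fin p) (Fin L) ℚ} (hA : IsFirstEntries A) {u v : Fin L → ℕ}
    (B : ∀ t, Matrix (Fin (u t)) (Fin (v t)) ℚ) (hB : ∀ t, IsImagePartitionRegular (B t))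
    {E : Set ℝ} (hE : E ∈ P) :
    ∃ X : ∀ t, Fin (v t) → S, ∀ (i : Fin p) (j : ∀ t, Fin (u t)),
      ∑ t, (A i t : ℝ) * ∑ s, (B t (j t) s : ℝ) * (X t s : ℝ) ∈ E := by
  obtain ⟨hA0, d, hd, hAd⟩ := hA
  choose lA hlA hlA0 using fun i => exists_first_nonzero (A i) (hA0 i)
  choose m H ℓ hH0 hH1 hℓ using fun t => (hB t).exists_leading
  -- The columns of the inserted matrix, enumerated in lexicographic order.
  let φ : Fin (Fintype.card (Σₗ t, Fin (m t))) ≃o (Σₗ t, Fin (m t)) :=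
    Fintype.orderIsoFinOfCardEq _ rfl
  let idx : ∀ t, Fin (m t) → Fin (Fintype.card (Σₗ t, Fin (m t))) := fun t k =>
    φ.symm (toLex ⟨t, k⟩)
  let G : Fin p × (∀ t, Fin (u t)) → Fin (Fintype.card (Σₗ t, Fin (m t))) → ℚ := fun ij k =>
    A ij.1 (ofLex (φ k)).1 *
      (B (ofLex (φ k)).1).mulVec (H _ (ofLex (φ k)).2) (ij.2 (ofLex (φ k)).1)
  have hGidx : ∀ ij t k, G ij (idx t k) = A ij.1 t * (B t).mulVec (H t k) (ij.2 t) := by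
    intro ij t k
    simp only [G, idx]
    rw [φ.apply_symm_apply]
    rfl
  have hidx : ∀ k, ∃ t k', k = idx t k' := fun k =>
    ⟨(ofLex (φ k)).1, (ofLex (φ k)).2, (φ.symm_apply_apply k).symm⟩
  have hlt : ∀ {t k t' k'}, idx t k < idx t' k' → t < t' ∨ ∃ h : t = t', h ▸ k < k' := by
    intro t k t' k' h
    exact Sigma.Lex.lt_def.1 (φ.symm.lt_iff_lt.1 h)
  obtain ⟨c, hc, hcH⟩ := exists_common_denominator
    (fun x : Σ t, Fin (m t) × Fin (v t) => H x.1 x.2.1 x.2.2) fun x => hH0 _ _ _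
  choose n hn using hcH
  have hcQ : (0 : ℚ) < c := by exact_mod_cast hc
  obtain ⟨z, hz, hzP⟩ := hP.exists_ultrafilter hS hdil _ G
    (fun ij => idx (lA ij.1) (ℓ _ (ij.2 (lA ij.1)))) (fun k => d (ofLex (φ k)).1) (fun k => hd _)
    (fun ij => by
      rw [hGidx, (hℓ _ _).1, mul_one, hAd _ _ (hlA ij.1) (hlA0 ij.1)]
      simp only [idx]
      rw [φ.apply_symm_apply]
      rfl)
    (fun ij k hk => by
      obtain ⟨t, k, rfl⟩ := hidx k
      rw [hGidx]
      rcases hlt hk with h | ⟨h, h'⟩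
      · rw [hlA0 _ _ h, zero_mul]
      · subst h
        rw [(hℓ _ _).2 k h', mul_zero]) c hc
  have hEz : ∀ᶠ w in (z : Filter (Fin (Fintype.card (Σₗ t, Fin (m t))) → ℝ)),
      ∀ ij, rowEval (G ij) w ∈ E := by
    refine Filter.eventually_all.2 fun ij => ?_
    have hE' := hE
    rw [← hzP ij] at hE'
    exact hE'
  obtain ⟨w, hwS, hwE⟩ := ((hz 1 one_pos).and hEz).exists
  choose τ hτ hwτ using fun k => (hwS k).1
  have hX : ∀ t s, ∑ k, (H t k s : ℝ) * w (idx t k) ∈ S := by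
    intro t s
    have hterm : ∀ k, (H t k s : ℝ) * w (idx t k) = n ⟨t, k, s⟩ • τ (idx t k) := fun k => by
      have h : (c : ℝ) * (H t k s : ℝ) = n ⟨t, k, s⟩ := by exact_mod_cast hn ⟨t, k, s⟩
      rw [hwτ, nsmul_eq_mul, ← h]
      ring
    obtain ⟨k₀, hk₀⟩ := hH1 t s
    have hn0 : 0 < n ⟨t, k₀, s⟩ := by
      have h := hn ⟨t, k₀, s⟩
      have h' := mul_pos hcQ hk₀
      dsimp only at h
      rw [h] at h'
      exact_mod_cast h'
    simp only [hterm]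
    rw [← Finset.add_sum_erase _ _ (Finset.mem_univ k₀)]
    refine AddSubsemigroup.add_mem_of_adjoinZero ?_
      (sum_mem fun k _ => nsmul_mem (AddSubsemigroup.mem_adjoinZero (hτ _)) _)
    rw [nsmul_eq_mul]
    exact AddSubsemigroup.natCast_mul_mem hn0 (hτ _)
  refine ⟨fun t s => ⟨_, hX t s⟩, fun i j => ?_⟩
  convert hwE (i, j) using 1
  let ψ : (Σ t, Fin (m t)) ≃ Fin (Fintype.card (Σₗ t, Fin (m t))) := toLex.trans φ.symm.toEquiv
  rw [rowEval, ← ψ.sum_comp, Fintype.sum_sigma]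
  refine Finset.sum_congr rfl fun t _ => ?_
  have hψ : ∀ k, ψ ⟨t, k⟩ = idx t k := fun k => rfl
  simp only [hψ, hGidx, Matrix.mulVec, dotProduct, Finset.mul_sum, Rat.cast_mul, Rat.cast_sum,
    Finset.sum_mul]
  rw [Finset.sum_comm]
  exact Finset.sum_congr rfl fun k _ => Finset.sum_congr rfl fun s _ => by ring

/-! ### Infinite sums of blocks -/

/-- If the finite sets `V n x` can be placed in any member of the idempotent `P` by the choice of
`x`, then successive choices put all finite sums of their elements, with at most one summand from
each set, into a given member of `P`. -/
theorem exists_sums_mem_of_idempotent {P : Ultrafilter ℝ} (hP : P + P = P) {X : ℕ → Type*}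
    (V : ∀ n, X n → Set ℝ) (hV : ∀ n, ∀ E ∈ P, ∃ x, (V n x).Finite ∧ V n x ⊆ E)
    {E : Set ℝ} (hE : E ∈ P) :
    ∃ x : ∀ n, X n, ∀ a : ℕ → ℝ, (∀ n, a n = 0 ∨ a n ∈ V n (x n)) →
      ∀ N, (∀ n < N, a n ∉ V n (x n)) ∨ ∑ n ∈ Finset.range N, a n ∈ E := by
  -- For `F ∈ P = P + P`, almost every `r ∈ F` has `r + y ∈ F` for almost every `y`.
  have hstar : ∀ F ∈ P, F ∩ {r | {y | r + y ∈ F} ∈ P} ∈ P := by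
    intro F hF
    refine Filter.inter_mem hF ?_
    rw [← hP] at hF
    exact hF
  choose g hgfin hg using fun (n : ℕ) (F : {F : Set ℝ // F ∈ P}) => hV n _ (hstar F.1 F.2)
  -- The sums of values from later blocks are kept in the set where adding a value from the
  -- current block, or not adding one, stays in `F`.
  let next : ℕ → {F : Set ℝ // F ∈ P} → {F : Set ℝ // F ∈ P} := fun n F =>
    ⟨F.1 ∩ ⋂ r ∈ V n (g n F), {y | r + y ∈ F.1}, Filter.inter_mem F.2
      ((Filter.biInter_mem (hgfin n F)).2 fun r hr => (hg n F hr).2)⟩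
  let F : ℕ → {F : Set ℝ // F ∈ P} := fun n => Nat.rec ⟨E, hE⟩ next n
  have hF : ∀ n, F (n + 1) = next n (F n) := fun n => rfl
  refine ⟨fun n => g n (F n), fun a ha N => ?_⟩
  obtain ⟨W, hW⟩ : ∃ W : ℕ → Set ℝ, ∀ n, V n (g n (F n)) = W n := ⟨_, fun _ => rfl⟩
  simp only [hW] at ha ⊢
  suffices h : ∀ N k, (∀ n < N, a (k + n) ∉ W (k + n)) ∨
      ∑ n ∈ Finset.range N, a (k + n) ∈ (F k).1 by
    have h0 := h N 0
    simp only [Nat.zero_add] at h0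
    exact h0
  intro N
  induction N with
  | zero => exact fun k => Or.inl fun n hn => absurd hn n.not_lt_zero
  | succ N ih =>
    intro k
    have hshift : ∀ n, k + 1 + n = k + (n + 1) := fun n => by omega
    rw [Finset.sum_range_succ', add_zero]
    have h := ih (k + 1)
    simp only [hshift] at h
    by_cases hk : a k ∈ W k
    · right
      have hk' : a k ∈ V k (g k (F k)) := by rwa [hW]
      rcases h with h | h
      · rw [Finset.sum_eq_zero fun n hn => (ha _).resolve_right (h n (Finset.mem_range.1 hn)),
          zero_add]
        exact (hg k (F k) hk').1
      · rw [hF] at h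
        rw [add_comm]
        exact Set.mem_iInter₂.1 h.2 _ hk'
    · rw [(ha k).resolve_right hk, add_zero]
      refine h.imp (fun h n hn => ?_) fun h => ?_
      · cases n with
        | zero => exact hk
        | succ n => exact h n (by omega)
      · rw [hF] at h
        exact h.1

theorem exists_block_index {g : ℕ → ℕ} (hg : StrictMono g) (h0 : g 0 = 0) (k : ℕ) :
    ∃ n, g n ≤ k ∧ k < g (n + 1) := by
  have hex : ∃ n, k < g n := ⟨k + 1, hg.id_le (k + 1)⟩
  have hne : Nat.find hex ≠ 0 := fun h => by
    have := Nat.find_spec hex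
    rw [h, h0] at this
    omega
  obtain ⟨n, hn⟩ := Nat.exists_eq_succ_of_ne_zero hne
  refine ⟨n, not_lt.1 (Nat.find_min hex (by omega)), ?_⟩
  rw [← Nat.succ_eq_add_one, ← hn]
  exact Nat.find_spec hex

theorem block_index_unique {g : ℕ → ℕ} (hg : StrictMono g) {k n n' : ℕ} (h : g n ≤ k)
    (h' : k < g (n + 1)) (h₁ : g n' ≤ k) (h₁' : k < g (n' + 1)) : n = n' := by
  have h2 := hg.lt_iff_lt.1 (h.trans_lt h₁')
  have h3 := hg.lt_iff_lt.1 (h₁.trans_lt h')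
  omega

theorem sum_range_blocks (len : ℕ → ℕ) (f : ℕ → ℝ) (N : ℕ) :
    ∑ k ∈ Finset.range (∑ r ∈ Finset.range N, len r), f k =
      ∑ n ∈ Finset.range N, ∑ s : Fin (len n), f ((∑ r ∈ Finset.range n, len r) + s) := by
  induction N with
  | zero => simp
  | succ N ih =>
    rw [Finset.sum_range_succ len, Finset.sum_range_add, ih, Finset.sum_range_succ _ N,
      Finset.sum_range (n := len N)]

/-- A dependent family given along an injection into `ℕ` extends to all of `ℕ`; this glues vectors
whose lengths depend on the index without casting between equal lengths. -/
theorem exists_dependent_extension {α : Type*} {β : ℕ → Type*} [∀ n, Nonempty (β n)]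
    {f : α → ℕ} (hf : Function.Injective f) (x : ∀ s, β (f s)) :
    ∃ X : ∀ n, β n, ∀ s, X (f s) = x s := by
  have h : ∀ n, ∃ y : β n, ∀ s (h : f s = n), h ▸ x s = y := by
    intro n
    by_cases hn : ∃ s, f s = n
    · obtain ⟨s, rfl⟩ := hn
      refine ⟨x s, fun s' h' => ?_⟩
      obtain rfl := hf h'
      rfl
    · exact ⟨Classical.arbitrary _, fun s hs => absurd ⟨s, hs⟩ hn⟩
  choose X hX using h
  exact ⟨X, fun s => (hX _ s rfl).symm⟩

/-- The image under one row of an insertion matrix, computed blockwise. -/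
theorem finsum_isConcat {v : ℕ → ℕ} (hv : ∀ t, 0 < v t) {w : ∀ t, Fin (v t) → ℚ} {ρ : ℕ → ℚ}
    (hρ : IsConcat v w ρ) {T : ℕ} (hT : ∀ t, T ≤ t → w t = 0) (x : ℕ → ℝ) :
    ∑ᶠ k, (ρ k : ℝ) * x k = ∑ t ∈ Finset.range T, ∑ s : Fin (v t),
      (w t s : ℝ) * x ((∑ r ∈ Finset.range t, v r) + s) := by
  have hmono : StrictMono fun t => ∑ r ∈ Finset.range t, v r :=
      strictMono_nat_of_lt_succ fun t => by
        rw [Finset.sum_range_succ]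
        exact Nat.lt_add_of_pos_right (hv t)
  have hsupp : (Function.support fun k => (ρ k : ℝ) * x k) ⊆
      ↑(Finset.range (∑ r ∈ Finset.range T, v r)) := by
    intro k hk
    rw [Finset.coe_range, Set.mem_Iio]
    by_contra hcon
    obtain ⟨t, ht, ht'⟩ := exists_block_index hmono (by simp) k
    have hTt : T ≤ t := by
      by_contra! hlt
      have : ∑ r ∈ Finset.range (t + 1), v r ≤ ∑ r ∈ Finset.range T, v r :=
        hmono.monotone (show t + 1 ≤ T from hlt)
      omega
    rw [Finset.sum_range_succ] at ht'
    have h := hρ t ⟨k - ∑ r ∈ Finset.range t, v r, by omega⟩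
    rw [hT t hTt, Fin.val_mk, Nat.add_sub_cancel' ht] at h
    exact hk (by simp [h])
  rw [finsum_eq_sum_of_support_subset _ hsupp, sum_range_blocks]
  exact Finset.sum_congr rfl fun t _ => Finset.sum_congr rfl fun s _ => by rw [hρ t s]

theorem exists_concat_vector {σ : Type*} [Nonempty σ] {v : ℕ → ℕ} (X : ∀ t, Fin (v t) → σ) :
    ∃ x : ℕ → σ, ∀ t (s : Fin (v t)), x ((∑ r ∈ Finset.range t, v r) + s) = X t s := by
  have hlt : ∀ {t t' : ℕ} (s : Fin (v t)) (s' : Fin (v t')), t < t' →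
      (∑ r ∈ Finset.range t, v r) + (s : ℕ) < (∑ r ∈ Finset.range t', v r) + (s' : ℕ) := by
    intro t t' s s' h
    have : ∑ r ∈ Finset.range (t + 1), v r ≤ ∑ r ∈ Finset.range t', v r :=
      Finset.sum_le_sum_of_subset (Finset.range_mono h)
    rw [Finset.sum_range_succ] at this
    have := s.2
    omega
  have hinj : Function.Injective fun ts : Σ t, Fin (v t) =>
      (∑ r ∈ Finset.range ts.1, v r) + (ts.2 : ℕ) := by
    rintro ⟨t, s⟩ ⟨t', s'⟩ h
    dsimp only at h
    rcases lt_trichotomy t t' with h1 | rfl | h1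
    · exact absurd h (hlt s s' h1).ne
    · rw [Fin.ext (Nat.add_left_cancel h)]
    · exact absurd h (hlt s' s h1).ne'
  exact ⟨Function.extend _ (fun ts : Σ t, Fin (v t) => X ts.1 ts.2) fun _ => Classical.arbitrary σ,
    fun t s => hinj.extend_apply _ _ ⟨t, s⟩⟩

/-! ### Insertion into segmented first entries matrices -/

theorem corollary3p7 (S : AddSubsemigroup ℝ) (hSpos : ∀ s ∈ S, 0 < s)
    (hSdense : Set.Ioi (0 : ℝ) ⊆ closure (S : Set ℝ))
    (hcS : ∀ c : ℕ, 0 < c → IsCentralStarNearZero S (dilate S c))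
    (C : Matrix ℕ ℕ ℚ) (hC : IsSegmentedFirstEntries C)
    (u v : ℕ → ℕ) (hu : ∀ t, 0 < u t) (hv : ∀ t, 0 < v t)
    (B : ∀ t, Matrix (Fin (u t)) (Fin (v t)) ℚ)
    (hB : ∀ t, IsImagePartitionRegular (B t))
    (D : Matrix ℕ ℕ ℚ) (hD : IsInsertionMatrix B C D) :
    IsCentrallyImagePartitionRegularNearZero S D := by
  rintro E ⟨p, hp, hEp⟩
  set P : Ultrafilter ℝ := p.map ((↑) : S → ℝ)
  have hP : IsMinimalIdempotentAtZero S P := hp.map_coe hSpos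
  have hdil : ∀ c : ℕ, 0 < c → ∀ᶠ x in (P : Filter ℝ), ∃ t ∈ S, x = c * t := by
    intro c hc
    change ∀ᶠ s : S in (p : Filter S), ∃ t ∈ S, (s : ℝ) = c * t
    have h : dilate S c ∈ p := hcS c hc p hp
    filter_upwards [h] with s ⟨t, ht⟩ using ⟨t, t.2, ht⟩
  have hEP : ((↑) : S → ℝ) '' E ∈ P := by
    have h : ∀ᶠ s in (p : Filter S), s ∈ E := hEp
    change ∀ᶠ s : S in (p : Filter S), (s : ℝ) ∈ ((↑) : S → ℝ) '' E
    exact h.mono fun s hs => ⟨s, hs, rfl⟩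
  have : Nonempty S := (hP.small 1 one_pos).exists.elim fun x hx => ⟨⟨x, hx.1⟩⟩
  obtain ⟨hC0, hCfin, α, hα, hα0, hblock⟩ := hC
  let val : ∀ (n i : ℕ) (j : ∀ t, Fin (u t)) (X : ∀ t, Fin (v t) → S), ℝ := fun n i j X =>
    ∑ t : Fin (α (n + 1) - α n), (C i (α n + t) : ℝ) *
      ∑ s, (B (α n + t) (j (α n + t)) s : ℝ) * (X (α n + t) s : ℝ)
  -- The values of the nonzero rows of the `n`-th block of columns.
  let V : ∀ _ : ℕ, (∀ t, Fin (v t) → S) → Set ℝ := fun n X =>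
    {r | ∃ i j, (fun s : Fin (α (n + 1) - α n) => C i (α n + s)) ≠ 0 ∧ val n i j X = r}
  have hV : ∀ n, ∀ F ∈ P, ∃ X, (V n X).Finite ∧ V n X ⊆ F := by
    intro n F hF
    rcases hblock n with hempty | ⟨q, A, -, hA, hrange⟩
    · have hVn : ∀ X, V n X = ∅ := fun X => by
        refine Set.eq_empty_of_forall_notMem fun r hr => ?_
        obtain ⟨i, _, hi, _⟩ := hr
        have : (fun s : Fin (α (n + 1) - α n) => C i (α n + s)) ∈
            nonzeroBlockRows C (α n) (α (n + 1)) := ⟨⟨i, rfl⟩, hi⟩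
        rw [hempty] at this
        exact this
      let X₀ : ∀ t, Fin (v t) → S := fun _ _ => Classical.arbitrary S
      exact ⟨X₀, Set.finite_empty.subset (hVn X₀).subset,
        (hVn X₀).subset.trans (Set.empty_subset F)⟩
    · obtain ⟨X', hX'⟩ := hP.exists_image_of_insertion hSpos hdil hA
        (fun t : Fin (α (n + 1) - α n) => B (α n + t)) (fun t => hB _) hF
      obtain ⟨X, hX⟩ := exists_dependent_extension (β := fun t => Fin (v t) → S)
        (f := fun t : Fin (α (n + 1) - α n) => α n + (t : ℕ))
        (fun s s' h => Fin.ext (Nat.add_left_cancel h)) X'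
      have hsub : V n X ⊆ Set.range fun ij : Fin q × (∀ t : Fin (α (n + 1) - α n),
          Fin (u (α n + t))) => ∑ t, (A ij.1 t : ℝ) *
            ∑ s, (B (α n + t) (ij.2 t) s : ℝ) * (X' t s : ℝ) := by
        rintro r ⟨i, j, hi, rfl⟩
        have : (fun s : Fin (α (n + 1) - α n) => C i (α n + s)) ∈ Set.range A.row := by
          rw [hrange]
          exact ⟨⟨i, rfl⟩, hi⟩
        obtain ⟨i', hi'⟩ := this
        refine ⟨(i', fun t => j _), Finset.sum_congr rfl fun t _ => ?_⟩
        have h1 : A i' t = C i (α n + t) := congrFun hi' t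
        rw [h1, ← hX t]
      refine ⟨X, (Set.finite_range _).subset hsub, hsub.trans ?_⟩
      rintro _ ⟨ij, rfl⟩
      exact hX' ij.1 ij.2
  obtain ⟨Y, hY⟩ := exists_sums_mem_of_idempotent hP.idem V hV hEP
  choose blk hblk hblk' using exists_block_index hα hα0
  have hblkα : ∀ n (s : Fin (α (n + 1) - α n)), blk (α n + s) = n := fun n s => by
    have := s.2
    exact block_index_unique hα (hblk _) (hblk' _) (Nat.le_add_right _ _) (by omega)
  obtain ⟨x, hx⟩ := exists_concat_vector fun t s => Y (blk t) t s
  refine ⟨x, fun row => ?_⟩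
  obtain ⟨i, j, hρ⟩ : D row ∈ {ρ | ∃ (i : ℕ) (j : ∀ t, Fin (u t)),
      IsConcat v (fun t => C i t • B t (j t)) ρ} := by
    rw [← hD]
    exact ⟨row, rfl⟩
  obtain ⟨b, hb⟩ := (hCfin i).bddAbove
  have hN : ∀ t, α (b + 1) ≤ t → C i t = 0 := fun t ht => by
    by_contra hne
    have h1 : t ≤ b := hb hne
    have h2 : b + 1 ≤ α (b + 1) := hα.id_le _
    omega
  have hαsum : ∀ n, ∑ r ∈ Finset.range n, (α (r + 1) - α r) = α n := fun n => by
    rw [Finset.sum_range_tsub hα.monotone, hα0, Nat.sub_zero]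
  have hrow : ∑ᶠ k, (D row k : ℝ) * (x k : ℝ) =
      ∑ n ∈ Finset.range (b + 1), val n i j (Y n) := by
    rw [finsum_isConcat hv hρ (T := α (b + 1)) (fun t ht => by simp [hN t ht]) fun k => (x k : ℝ)]
    obtain ⟨f, hf⟩ : ∃ f : ℕ → ℝ, ∀ t, f t = ∑ s : Fin (v t), (((C i t • B t (j t)) s : ℚ) : ℝ) *
        (x ((∑ r ∈ Finset.range t, v r) + s) : ℝ) := ⟨_, fun _ => rfl⟩
    have hsum := sum_range_blocks (fun r => α (r + 1) - α r) f (b + 1)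
    simp only [hαsum] at hsum
    simp only [← hf]
    rw [hsum]
    refine Finset.sum_congr rfl fun n _ => Finset.sum_congr rfl fun t _ => ?_
    rw [hf, Finset.mul_sum]
    refine Finset.sum_congr rfl fun s _ => ?_
    rw [hx, hblkα n t, Pi.smul_apply, smul_eq_mul, Rat.cast_mul, mul_assoc]
  rw [hrow]
  have hmem : ∀ n, (fun s : Fin (α (n + 1) - α n) => C i (α n + s)) ≠ 0 →
      val n i j (Y n) ∈ V n (Y n) := fun n h => ⟨i, j, h, rfl⟩
  rcases hY (fun n => val n i j (Y n)) (fun n => by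
    by_cases h : (fun s : Fin (α (n + 1) - α n) => C i (α n + s)) = 0
    · exact Or.inl (Finset.sum_eq_zero fun t _ => by
        have : C i (α n + t) = 0 := congrFun h t
        rw [this, Rat.cast_zero, zero_mul])
    · exact Or.inr (hmem n h)) (b + 1) with h | ⟨e, he, h⟩
  · exfalso
    refine hC0 i (funext fun t => ?_)
    by_contra hne
    have hlt : α (blk t) < α (b + 1) :=
      (hblk t).trans_lt (not_le.1 fun hle => hne (hN t hle))
    refine h (blk t) (hα.lt_iff_lt.1 hlt) (hmem _ fun h0 => hne ?_)
    have := congrFun h0 ⟨t - α (blk t), by have := hblk t; have := hblk' t; omega⟩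
    simpa [Nat.add_sub_cancel' (hblk t)] using this
  · exact ⟨e, he, h.symm⟩
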